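/- Let $G$ be a finite chordal graph with at least one edge (every cycle of length at least $4$ has a chord), and let $s$ be its clique number. For an edge weighting $\omega:E(G)\to\mathbb R_{\ge 0}$ with $\omega(G):=\sum_{e\in E(G)}\omega(e)\neq 0$ put $t_\omega(G):=\omega(T_\omega)/\omega(G)$, where $T_\omega$ is a maximum weight spanning tree of $G$ (a maximum weight spanning forest, with one tree in each component, if $G$ is not connected). Let $W^{0-1}$ be the set of all weightings $\omega:E(G)\to\{0,1\}$ that are not identically $0$. A clique graph of a connected graph $F$ is a graph $F_c$ whose vertices are the (inclusion-)maximal cliques of $F$ and which is obtained as follows. Start with $F'=\emptyset$ and no edges. Repeatedly choose a maximal clique $C$ of $F$ that is not a subgraph of $F'$. If $V(C)\cap V(F')\neq\emptyset$, write $V(C)\cap V(F')$ as a union of nonempty cliques $S_1,\dots,S_k$ of $F'$, choose for each $i$ a previously chosen maximal clique $C_i$ with $S_i\subseteq C_i$, and add the edges $CC_1,\dots,CC_k$ to $F_c$. In either case replace $F'$ by $F'\cup C$. Stop when $F'=F$ and all maximal cliques have been chosen. Then there is a weighting $\omega^*\in W^{0-1}$ minimizing $t_\omega(G)$ over $\omega\in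 W^{0-1}$ such that the subgraph $F$ of $G$ induced by the edge set $\{e\in E(G):\omega^*(e)=1\}$ has the following properties. (1) $F$ is a connected chordal graph, and for every clique graph $F_c$ of $F$ that is a tree, every maximal clique of $F$ that is a leaf of $F_c$ is a maximal clique of $G$ (if $F_c$ has only one vertex, this vertex counts as a leaf). (2) $d_F(v)\ge \frac s2$ for every $v\in V(F)$. (3) $\frac1{s-1}\le t_{\omega^*}(G)\le\frac2s$. -/

import Mathlib

namespace SimpleGraph

/-! ### Chordal graphs -/

/-- A graph is chordal if every cycle of length at least four has a chord: an edge of the graph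
that joins two vertices of the cycle and is not an edge of the cycle. -/
def IsChordal {V : Type*} (G : SimpleGraph V) : Prop :=
  ∀ (v : V) (c : G.Walk v v), c.IsCycle → 4 ≤ c.length →
    ∃ x ∈ c.support, ∃ y ∈ c.support, G.Adj x y ∧ s(x, y) ∉ c.edges

/-! ### Edge weights, maximum spanning trees and the weighting ratio -/

/-- `T` is a spanning forest of `G`: an acyclic spanning subgraph with one tree in each
component of `G`. For connected `G` this means that `T` is a spanning tree. -/
def IsSpanningForest {V : Type*} (G T : SimpleGraph V) : Prop :=
  T ≤ G ∧ T.IsAcyclic ∧ T.Reachable = G.Reachable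

/-- For a connected graph the spanning forests are the spanning trees. -/
theorem isSpanningForest_iff_isTree {V : Type*} {G T : SimpleGraph V} (hG : G.Connected) :
    G.IsSpanningForest T ↔ T ≤ G ∧ T.IsTree := by
  constructor
  · rintro ⟨h1, h2, h3⟩
    exact ⟨h1, (hG.maximal_le_isAcyclic_iff_isTree h1).1
      ((maximal_isAcyclic_iff_reachable_eq h1 h2).2 h3)⟩
  · rintro ⟨h1, h2⟩
    exact ⟨h1, h2.isAcyclic, (maximal_isAcyclic_iff_reachable_eq h1 h2.isAcyclic).1
      ((hG.maximal_le_isAcyclic_iff_isTree h1).2 h2)⟩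

open scoped Classical in
/-- The total weight `ω(G)`. -/
noncomputable def totalWeight {V : Type*} [Fintype V] (G : SimpleGraph V)
    (ω : G.edgeSet → ℝ) : ℝ :=
  ∑ e : G.edgeSet, ω e

open scoped Classical in
/-- The weight `ω(T)` of a spanning subgraph `T` of `G`. -/
noncomputable def weightOf {V : Type*} [Fintype V] (G : SimpleGraph V)
    (ω : G.edgeSet → ℝ) (T : SimpleGraph V) : ℝ :=
  ∑ e : G.edgeSet, if (e : Sym2 V) ∈ T.edgeSet then ω e else 0

/-- The weight `ω(T_ω)` of a maximum weight spanning tree `T_ω` of `G` (spanning forest, when `G`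
is not connected). -/
noncomputable def maxSpanningWeight {V : Type*} [Fintype V] (G : SimpleGraph V)
    (ω : G.edgeSet → ℝ) : ℝ :=
  sSup {x : ℝ | ∃ T : SimpleGraph V, G.IsSpanningForest T ∧ x = G.weightOf ω T}

/-- The supremum in `maxSpanningWeight` is a maximum. -/
theorem isGreatest_maxSpanningWeight {V : Type*} [Fintype V] (G : SimpleGraph V)
    (ω : G.edgeSet → ℝ) :
    IsGreatest {x : ℝ | ∃ T : SimpleGraph V, G.IsSpanningForest T ∧ x = G.weightOf ω T}
      (G.maxSpanningWeight ω) := by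
  have hfin : {x : ℝ | ∃ T : SimpleGraph V, G.IsSpanningForest T ∧ x = G.weightOf ω T}.Finite := by
    refine (Set.finite_range (fun T : SimpleGraph V => G.weightOf ω T)).subset ?_
    rintro x ⟨T, -, rfl⟩
    exact ⟨T, rfl⟩
  have hne : {x : ℝ | ∃ T : SimpleGraph V, G.IsSpanningForest T ∧ x = G.weightOf ω T}.Nonempty := by
    obtain ⟨T, -, hT⟩ := exists_maximal_isAcyclic_of_le_isAcyclic (G := G) (H := ⊥) bot_le
      isAcyclic_bot
    exact ⟨_, T, ⟨hT.1.1, hT.1.2, G.reachable_eq_of_maximal_isAcyclic T hT⟩, rfl⟩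
  exact ⟨hne.csSup_mem hfin, fun x hx => le_csSup hfin.bddAbove hx⟩

/-- The weighting ratio `t_ω(G) = ω(T_ω) / ω(G)`; meaningful when `ω(G) ≠ 0`. -/
noncomputable def weightingRatio {V : Type*} [Fintype V] (G : SimpleGraph V)
    (ω : G.edgeSet → ℝ) : ℝ :=
  G.maxSpanningWeight ω / G.totalWeight ω

/-- The admissible 0-1 weightings: those with values in `{0, 1}` for which the ratio makes sense,
that is, which are not identically zero. -/
def IsZeroOneWeighting {V : Type*} (G : SimpleGraph V) (ω : G.edgeSet → ℝ) : Prop :=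
  (∀ e, ω e = 0 ∨ ω e = 1) ∧ ∃ e, ω e ≠ 0

/-- `ω` minimizes the weighting ratio over the 0-1 weightings. -/
def IsOptimalZeroOneWeighting {V : Type*} [Fintype V] (G : SimpleGraph V)
    (ω : G.edgeSet → ℝ) : Prop :=
  G.IsZeroOneWeighting ω ∧
    ∀ ω' : G.edgeSet → ℝ, G.IsZeroOneWeighting ω' → G.weightingRatio ω ≤ G.weightingRatio ω'

/-- The subgraph of `G` induced by the edge set `{e | ω e = 1}`: its edges are these edges, its
vertices are their end points. -/
def supportSubgraph {V : Type*} (G : SimpleGraph V) (ω : G.edgeSet → ℝ) : G.Subgraph where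
  verts := {x | ∃ y, ∃ h : G.Adj x y, ω ⟨s(x, y), h⟩ = 1}
  Adj x y := ∃ h : G.Adj x y, ω ⟨s(x, y), h⟩ = 1
  adj_sub := fun h => h.1
  edge_vert := fun h => ⟨_, h⟩
  symm := ⟨by
    rintro x y ⟨h, hω⟩
    refine ⟨h.symm, ?_⟩
    have : (⟨s(y, x), h.symm⟩ : G.edgeSet) = ⟨s(x, y), h⟩ := Subtype.ext Sym2.eq_swap
    rw [this]
    exact hω⟩

/-! ### Clique graphs -/

/-- The type of (inclusion-)maximal cliques of `G`. -/
abbrev MaxClique {V : Type*} (G : SimpleGraph V) : Type _ := {C : Set V // Maximal G.IsClique C}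

/-- The union, as a subgraph of `G`, of the complete graphs on the cliques in `P`. -/
def cliqueUnion {V : Type*} (G : SimpleGraph V) (P : Set G.MaxClique) : G.Subgraph :=
  ⨆ C ∈ P, (⊤ : G.Subgraph).induce C.1

/-- The graph with the edges from `C` to each of the `D i`. -/
def starEdges {α : Type*} (C : α) {k : ℕ} (D : Fin k → α) : SimpleGraph α :=
  SimpleGraph.fromEdgeSet (Set.range fun i => s(C, D i))

/-- The states `(P, H)` that the construction of a clique graph can reach: `P` is the set of the
maximal cliques placed so far (with union `G'`), `H` the graph built so far on them. In one step a
maximal clique `C` that is not contained in `G'` is placed. If it has no vertex in common with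
`G'`, then no edge is added. Otherwise the part of `C` in `G'` is written as a union of nonempty
cliques `S 1, …, S k` of `G'`, for every `i` a placed maximal clique `D i` containing `S i` is
chosen, and `C` is joined to all the `D i`. -/
inductive CliqueGraphState {V : Type*} (G : SimpleGraph V) :
    Set G.MaxClique → SimpleGraph G.MaxClique → Prop
  | start : CliqueGraphState G ∅ ⊥
  | disjoint (P : Set G.MaxClique) (H : SimpleGraph G.MaxClique) (C : G.MaxClique) :
      CliqueGraphState G P H →
      ¬ (⊤ : G.Subgraph).induce C.1 ≤ G.cliqueUnion P →
      C.1 ∩ (G.cliqueUnion P).verts = ∅ →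
      CliqueGraphState G (insert C P) H
  | meet (P : Set G.MaxClique) (H : SimpleGraph G.MaxClique) (C : G.MaxClique)
      (k : ℕ) (S : Fin k → Set V) (D : Fin k → G.MaxClique) :
      CliqueGraphState G P H →
      ¬ (⊤ : G.Subgraph).induce C.1 ≤ G.cliqueUnion P →
      (C.1 ∩ (G.cliqueUnion P).verts).Nonempty →
      (∀ i, (S i).Nonempty ∧ (G.cliqueUnion P).spanningCoe.IsClique (S i)) →
      (⋃ i, S i) = C.1 ∩ (G.cliqueUnion P).verts →
      (∀ i, D i ∈ P ∧ S i ⊆ (D i).1) →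
      CliqueGraphState G (insert C P) (H ⊔ starEdges C D)

/-- `H` is a clique graph of `G`: an output of the construction, with all the maximal cliques of
`G` as its vertices. -/
def IsCliqueGraph {V : Type*} (G : SimpleGraph V) (H : SimpleGraph G.MaxClique) : Prop :=
  G.CliqueGraphState Set.univ H

end SimpleGraph

/-! Optimizing over 0-1 weightings reduces to optimizing over vertex sets. Let `t` be the least
value of `(|U| - 1) / e(U)` over sets `U` spanning an edge, attained at `U` (`IsTightSet`). Given a
weighting with support `H`, a spanning forest of `H` extends to one of `G` and has `|K| - 1` edges
on each component `K`, which is at least `t * e(K)`; so its ratio is at least `t`. The indicator of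
the edges of `G[U]` attains `t`, since a forest has at most `|U| - 1` edges on `U`. Hence `F =
G[U]`, which is chordal.

Everything else is read off from minimality by testing `t` on other sets. Deleting a vertex of `U`
shows that degrees in `F` are at least `1 / t`; adding an outside vertex shows that it has at most
`1 / t` neighbours in `U`; splitting `U` gives connectedness; a maximum clique gives `t ≤ 2 / s`.
Simplicial elimination gives `e(U) ≤ (s - 1)(|U| - 1)`, hence `t ≥ 1 / (s - 1)`.

A leaf `C` of a clique graph has a vertex `v` in no other maximal clique, so `N_F(v) ⊆ C \ {v}`. If
`C` extended by `x` in `G`, then `x ∉ U`, yet `x` would have more neighbours in `U` than `v`,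
against the two degree bounds. -/

namespace SimpleGraph

/-! ### Simplicial vertices of chordal graphs -/

section Simplicial

variable {V : Type*} {G : SimpleGraph V}

/-- Walks of minimal length are chordless. -/
lemma Walk.eq_succ_of_adj_getVert_of_length_eq_dist {u v : V} (p : G.Walk u v)
    (hp : p.length = G.dist u v) {i j : ℕ} (hij : i < j) (hj : j ≤ p.length)
    (h : G.Adj (p.getVert i) (p.getVert j)) : j = i + 1 := by
  have := dist_le ((p.take i).append (Walk.cons h (p.drop j)))
  simp only [Walk.length_append, Walk.length_cons, Walk.take_length, Walk.drop_length] at this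
  omega

/-- Take a shortest path inside `G[S]`: a chord in `G` between two of its vertices is an edge of
`G[S]` and would shorten it. -/
lemma exists_chordless_path {S : Set V} (hS : (G.induce S).Connected) {u v : V}
    (hu : u ∈ S) (hv : v ∈ S) :
    ∃ p : G.Walk u v, p.IsPath ∧ (∀ x ∈ p.support, x ∈ S) ∧
      ∀ i j, i < j → j ≤ p.length → G.Adj (p.getVert i) (p.getVert j) → j = i + 1 := by
  obtain ⟨q, hq, hl⟩ := hS.exists_path_of_dist ⟨u, hu⟩ ⟨v, hv⟩
  let f : G.induce S →g G := (Embedding.induce S).toHom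
  have hf : ∃ p : G.Walk (f ⟨u, hu⟩) (f ⟨v, hv⟩), p.IsPath ∧ (∀ x ∈ p.support, x ∈ S) ∧
      ∀ i j, i < j → j ≤ p.length → G.Adj (p.getVert i) (p.getVert j) → j = i + 1 := by
    refine ⟨q.map f, hq.map Subtype.val_injective, ?_, ?_⟩
    · intro x hx
      rw [Walk.support_map, List.mem_map] at hx
      obtain ⟨y, -, rfl⟩ := hx
      exact y.2
    · intro i j hij hj h
      rw [Walk.length_map] at hj
      rw [Walk.getVert_map, Walk.getVert_map] at h
      exact q.eq_succ_of_adj_getVert_of_length_eq_dist hl hij hj h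
  exact hf

/-- In a chordal graph, two neighbours of a connected set `A` are adjacent if they have a common
neighbour which is neither in `A` nor adjacent to `A`. -/
lemma IsChordal.adj_of_common_neighbor (hG : G.IsChordal) {A : Set V}
    (hA : (G.induce A).Connected) {a a' w w' b : V} (ha : a ∈ A) (ha' : a' ∈ A)
    (hwa : G.Adj w a) (hwa' : G.Adj w' a') (hb : ∀ x ∈ A, ¬ G.Adj b x) (hbA : b ∉ A)
    (hbw : G.Adj b w) (hbw' : G.Adj b w') (hne : w ≠ w') : G.Adj w w' := by
  by_contra hnadj
  have h1 : (G.induce ({w} ∪ A)).Connected :=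
    connected_induce_union Preconnected.of_subsingleton hA.preconnected
      (Set.mem_singleton w) ha hwa
  have h2 : (G.induce ({w'} ∪ ({w} ∪ A))).Connected :=
    connected_induce_union Preconnected.of_subsingleton h1.preconnected
      (Set.mem_singleton w') (Or.inr ha') hwa'
  -- If `w`, `w'` are not adjacent, closing this path through `b` gives a cycle of length at least
  -- 4. It has no chord: the path is chordless, and on it `b` is adjacent only to `w` and `w'`.
  obtain ⟨p, hp, hpS, hch⟩ := exists_chordless_path h2 (u := w) (v := w')
    (by simp) (by simp)
  have hbp : b ∉ p.support := fun h => by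
    rcases hpS b h with h | h | h
    · exact hbw'.ne h
    · exact hbw.ne h
    · exact hbA h
  have hlen : 2 ≤ p.length := by
    by_contra hlt
    have h0 : p.length ≠ 0 := fun h0 => hne (Walk.eq_of_length_eq_zero h0)
    exact hnadj (Walk.adj_of_length_eq_one (p := p) (by omega))
  have hcyc : (Walk.cons hbw (p.concat hbw'.symm)).IsCycle := by
    rw [Walk.cons_isCycle_iff]
    refine ⟨hp.concat hbp _, ?_⟩
    rw [Walk.edges_concat]
    simp only [List.concat_eq_append, List.mem_append, List.mem_singleton, not_or]
    refine ⟨fun h => hbp (Walk.fst_mem_support_of_mem_edges _ h), ?_⟩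
    simp [hbw'.ne, hne]
  obtain ⟨x, hx, y, hy, hxy, hne'⟩ := hG _ _ hcyc (by simp; omega)
  have key : ∀ y, y ∈ p.support → G.Adj b y →
      s(b, y) ∈ (Walk.cons hbw (p.concat hbw'.symm)).edges := by
    intro y hy hby
    simp only [Walk.edges_cons, Walk.edges_concat, List.concat_eq_append, List.mem_cons,
      List.mem_append, List.not_mem_nil, or_false]
    rcases hpS y hy with h | h | h
    · rw [Set.mem_singleton_iff.1 h]
      exact Or.inr (Or.inr Sym2.eq_swap)
    · rw [Set.mem_singleton_iff.1 h]
      exact Or.inl rfl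
    · exact absurd hby (hb y h)
  have key2 : ∀ i j, i < j → j ≤ p.length → G.Adj (p.getVert i) (p.getVert j) →
      s(p.getVert i, p.getVert j) ∈ (Walk.cons hbw (p.concat hbw'.symm)).edges := by
    intro i j hij hj h
    obtain rfl := hch i j hij hj h
    simp only [Walk.edges_cons, Walk.edges_concat, List.concat_eq_append, List.mem_cons,
      List.mem_append]
    exact Or.inr (Or.inl (p.adj_toSubgraph_iff_mem_edges.1
      (p.toSubgraph_adj_getVert (by omega))))
  have hsup : ∀ z, z ∈ (Walk.cons hbw (p.concat hbw'.symm)).support →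
      z = b ∨ z ∈ p.support := by
    intro z hz
    simp only [Walk.support_cons, Walk.support_concat, List.mem_cons, List.mem_append,
      List.not_mem_nil, or_false] at hz
    tauto
  rcases hsup x hx with rfl | hx'
  · rcases hsup y hy with rfl | hy'
    · exact hxy.ne rfl
    · exact hne' (key y hy' hxy)
  · rcases hsup y hy with rfl | hy'
    · exact hne' (Sym2.eq_swap ▸ key x hx' hxy.symm)
    · obtain ⟨i, rfl, hi⟩ := Walk.mem_support_iff_exists_getVert.1 hx'
      obtain ⟨j, rfl, hj⟩ := Walk.mem_support_iff_exists_getVert.1 hy'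
      rcases lt_trichotomy i j with h | rfl | h
      · exact hne' (key2 i j h hj hxy)
      · exact hxy.ne rfl
      · exact hne' (Sym2.eq_swap ▸ key2 j i h hi hxy.symm)

/-- Every nonempty finite set `U` of vertices of a chordal graph `G` contains a simplicial vertex
of `G[U]`. -/
theorem IsChordal.exists_isClique_inter_neighborSet (hG : G.IsChordal) [Finite V] {U : Set V}
    (hU : U.Nonempty) : ∃ v ∈ U, G.IsClique (U ∩ G.neighborSet v) := by
  induction hn : U.ncard using Nat.strong_induction_on generalizing U with
  | _ n ih =>
  subst hn
  by_cases hcl : G.IsClique U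
  · obtain ⟨v, hv⟩ := hU
    exact ⟨v, hv, hcl.subset Set.inter_subset_left⟩
  -- `B A` is the part of `U` that is anticomplete to `A`. A maximal connected `A` with `B A`
  -- nonempty makes the boundary of `A` complete to `B A`.
  let B : Set V → Set V := fun A => {b | b ∈ U ∧ b ∉ A ∧ ∀ x ∈ A, ¬ G.Adj b x}
  have hne : ∃ A, A ⊆ U ∧ (G.induce A).Connected ∧ (B A).Nonempty := by
    simp only [IsClique, Set.Pairwise, not_forall] at hcl
    obtain ⟨x, hx, y, hy, hxy, hnadj⟩ := hcl
    refine ⟨{x}, by simpa using hx, ?_, y, hy, by simpa using hxy.symm, ?_⟩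
    · have : Nonempty ({x} : Set V) := ⟨⟨x, rfl⟩⟩
      exact ⟨Preconnected.of_subsingleton⟩
    · rintro z rfl h
      exact hnadj h.symm
  obtain ⟨A, hA⟩ := (Set.toFinite {A | A ⊆ U ∧ (G.induce A).Connected ∧ (B A).Nonempty}).exists_maximal hne
  obtain ⟨⟨hAU, hAc, hAB⟩, hmax⟩ := hA
  have hAne : A.Nonempty := Set.nonempty_coe_sort.1 hAc.nonempty
  have hBU : (B A).ncard < U.ncard := by
    refine Set.ncard_lt_ncard ⟨fun b hb => hb.1, fun h => ?_⟩
    obtain ⟨a, ha⟩ := hAne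
    exact (h (hAU ha)).2.1 ha
  -- A vertex simplicial in `G[B A]` stays simplicial in `G[U]`: its further neighbours lie on the
  -- boundary of `A`, and they are pairwise adjacent by chordality.
  obtain ⟨b, hb, hbcl⟩ := ih _ hBU hAB rfl
  -- a vertex outside `A` with a neighbour in `A` is adjacent to everything in `B A`
  have hfull : ∀ w ∈ U, w ∉ A → ∀ a ∈ A, G.Adj w a → ∀ c ∈ B A, G.Adj c w := by
    intro w hw hwA a ha hwa c hc
    by_contra hcw
    have hconn : (G.induce ({w} ∪ A)).Connected :=
      connected_induce_union Preconnected.of_subsingleton hAc.preconnected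
        (Set.mem_singleton w) ha hwa
    refine hwA (hmax ⟨?_, hconn, c, hc.1, ?_, ?_⟩ Set.subset_union_right (Or.inl rfl))
    · exact Set.union_subset (by simpa using hw) hAU
    · rintro (rfl | h)
      · exact hc.2.2 a ha hwa
      · exact hc.2.1 h
    · rintro x (rfl | h)
      · exact hcw
      · exact hc.2.2 x h
  refine ⟨b, hb.1, ?_⟩
  have hcases : ∀ x ∈ U ∩ G.neighborSet b, x ∈ B A ∨ (x ∉ A ∧ ∃ a ∈ A, G.Adj x a) := by
    rintro x ⟨hxU, hbx⟩
    have hxA : x ∉ A := fun h => hb.2.2 x h hbx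
    by_cases h : ∃ a ∈ A, G.Adj x a
    · exact Or.inr ⟨hxA, h⟩
    · push Not at h
      exact Or.inl ⟨hxU, hxA, h⟩
  intro x hx y hy hxy
  rcases hcases x hx with hxB | ⟨hxA, a, ha, hxa⟩
  · rcases hcases y hy with hyB | ⟨hyA, a', ha', hya'⟩
    · exact hbcl ⟨hxB, hx.2⟩ ⟨hyB, hy.2⟩ hxy
    · exact hfull y hy.1 hyA a' ha' hya' x hxB
  · rcases hcases y hy with hyB | ⟨hyA, a', ha', hya'⟩
    · exact (hfull x hx.1 hxA a ha hxa y hyB).symm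
    · exact hG.adj_of_common_neighbor hAc ha ha' hxa hya' hb.2.2 hb.2.1 hx.2 hy.2 hxy

/-- Chordality passes to induced subgraphs. -/
lemma IsChordal.of_embedding {W : Type*} {H : SimpleGraph W} (f : H ↪g G) (hG : G.IsChordal) :
    H.IsChordal := by
  intro v c hc hl
  have hinj : Function.Injective f.toHom := f.injective
  obtain ⟨x, hx, y, hy, hxy, he⟩ := hG _ (c.map f.toHom)
    ((Walk.isCycle_map_iff_of_injective hinj).2 hc) (by rwa [Walk.length_map])
  rw [Walk.support_map, List.mem_map] at hx hy
  obtain ⟨x, hx, rfl⟩ := hx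
  obtain ⟨y, hy, rfl⟩ := hy
  refine ⟨x, hx, y, hy, f.map_adj_iff.1 hxy, fun h => he ?_⟩
  rw [Walk.edges_map, List.mem_map]
  exact ⟨_, h, rfl⟩

end Simplicial

/-! ### Edge counts on vertex sets -/

section Counting

variable {V : Type*}

/-- The edges of `G` with both end points in `U`. -/
def edgesOn (G : SimpleGraph V) (U : Set V) : Set (Sym2 V) :=
  {e ∈ G.edgeSet | ∀ v ∈ e, v ∈ U}

@[simp]
lemma mk_mem_edgesOn {G : SimpleGraph V} {U : Set V} {x y : V} :
    s(x, y) ∈ G.edgesOn U ↔ G.Adj x y ∧ x ∈ U ∧ y ∈ U := by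
  simp [edgesOn]

lemma edgesOn_mono_left {G H : SimpleGraph V} (h : H ≤ G) (U : Set V) :
    H.edgesOn U ⊆ G.edgesOn U :=
  fun _ he => ⟨edgeSet_mono h he.1, he.2⟩

lemma edgesOn_eq_image (G : SimpleGraph V) (U : Set V) :
    G.edgesOn U = Sym2.map Subtype.val '' (G.induce U).edgeSet := by
  ext e
  induction e with
  | _ x y =>
    simp only [mk_mem_edgesOn, Set.mem_image]
    constructor
    · rintro ⟨h, hx, hy⟩
      exact ⟨s(⟨x, hx⟩, ⟨y, hy⟩), h, rfl⟩
    · rintro ⟨e, he, heq⟩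
      induction e with
      | _ a b =>
        have hab : G.Adj a b := he
        rw [Sym2.map_mk, Sym2.eq_iff] at heq
        rcases heq with ⟨rfl, rfl⟩ | ⟨rfl, rfl⟩
        · exact ⟨hab, a.2, b.2⟩
        · exact ⟨hab.symm, b.2, a.2⟩

lemma ncard_edgesOn (G : SimpleGraph V) (U : Set V) :
    (G.edgesOn U).ncard = Nat.card (G.induce U).edgeSet := by
  rw [edgesOn_eq_image, Set.ncard_image_of_injective _ (Sym2.map.injective Subtype.val_injective),
    Nat.card_coe_set_eq]

@[simp]
lemma edgesOn_empty (G : SimpleGraph V) : G.edgesOn ∅ = ∅ := by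
  ext e
  induction e with
  | _ x y => simp

variable [Finite V]

lemma ncard_edgesOn_insert (G : SimpleGraph V) {U : Set V} {v : V} (hv : v ∉ U) :
    (G.edgesOn (insert v U)).ncard = (G.edgesOn U).ncard + (U ∩ G.neighborSet v).ncard := by
  have h : G.edgesOn (insert v U) = G.edgesOn U ∪ (fun w => s(v, w)) '' (U ∩ G.neighborSet v) := by
    ext e
    induction e with
    | _ x y =>
      simp only [mk_mem_edgesOn, Set.mem_union, Set.mem_image, Set.mem_insert_iff, Set.mem_inter_iff,
        mem_neighborSet, Sym2.eq_iff]
      constructor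
      · rintro ⟨h, rfl | hx, rfl | hy⟩
        · exact absurd rfl h.ne
        · exact Or.inr ⟨y, ⟨hy, h⟩, Or.inl ⟨rfl, rfl⟩⟩
        · exact Or.inr ⟨x, ⟨hx, h.symm⟩, Or.inr ⟨rfl, rfl⟩⟩
        · exact Or.inl ⟨h, hx, hy⟩
      · rintro (⟨h, hx, hy⟩ | ⟨z, ⟨hz, h⟩, ⟨rfl, rfl⟩ | ⟨rfl, rfl⟩⟩)
        · exact ⟨h, Or.inr hx, Or.inr hy⟩
        · exact ⟨h, Or.inl rfl, Or.inr hz⟩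
        · exact ⟨h.symm, Or.inr hz, Or.inl rfl⟩
  rw [h, Set.ncard_union_eq _ (Set.toFinite _) (Set.toFinite _),
    Set.ncard_image_of_injective _ (fun a b hab => Sym2.congr_right.1 hab)]
  rw [Set.disjoint_left]
  rintro _ he ⟨w, -, rfl⟩
  exact hv (mk_mem_edgesOn.1 he).2.1

lemma ncard_edgesOn_diff_singleton (G : SimpleGraph V) {U : Set V} {v : V} (hv : v ∈ U) :
    (G.edgesOn U).ncard = (G.edgesOn (U \ {v})).ncard + (U ∩ G.neighborSet v).ncard := by
  have h := G.ncard_edgesOn_insert (U := U \ {v}) (v := v) (by simp)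
  rw [Set.insert_sdiff_singleton, Set.insert_eq_of_mem hv] at h
  rw [h]
  congr 2
  ext w
  simp only [Set.mem_inter_iff, Set.mem_sdiff, Set.mem_singleton_iff, mem_neighborSet]
  constructor
  · rintro ⟨⟨h, -⟩, h'⟩
    exact ⟨h, h'⟩
  · rintro ⟨h, h'⟩
    exact ⟨⟨h, h'.ne'⟩, h'⟩

lemma ncard_edgesOn_of_isClique {G : SimpleGraph V} {U : Set V} (hU : G.IsClique U) :
    2 * (G.edgesOn U).ncard = U.ncard * (U.ncard - 1) := by
  induction U, Set.toFinite U using Set.Finite.induction_on with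
  | empty => simp
  | @insert v U hv _ ih =>
    have h1 : U ∩ G.neighborSet v = U := Set.inter_eq_left.2 fun w hw =>
      hU (Set.mem_insert _ _) (Set.mem_insert_of_mem _ hw) (fun h => hv (h ▸ hw))
    rw [ncard_edgesOn_insert _ hv, h1, Set.ncard_insert_of_notMem hv, mul_add,
      ih (hU.subset (Set.subset_insert _ _))]
    rcases U.ncard with _ | k
    · rfl
    · simp only [Nat.add_sub_cancel]
      ring

/-- Chordal graphs with clique number `s` have at most `(s - 1)(n - 1)` edges on `n` vertices. -/
lemma IsChordal.ncard_edgesOn_add_le {G : SimpleGraph V} (hG : G.IsChordal) {U : Set V}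
    (hU : U.Nonempty) :
    (G.edgesOn U).ncard + (G.cliqueNum - 1) ≤ (G.cliqueNum - 1) * U.ncard := by
  induction hn : U.ncard using Nat.strong_induction_on generalizing U with
  | _ n ih =>
  subst hn
  obtain ⟨v, hv, hcl⟩ := hG.exists_isClique_inter_neighborSet hU
  have hdeg : (U ∩ G.neighborSet v).ncard + 1 ≤ G.cliqueNum := by
    have hcl' : G.IsClique (insert v (U ∩ G.neighborSet v)) :=
      hcl.insert fun w hw _ => hw.2
    have hvn : v ∉ U ∩ G.neighborSet v := fun h => G.loopless.irrefl v h.2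
    rw [← Set.ncard_insert_of_notMem hvn, Set.ncard_eq_toFinset_card _ (Set.toFinite _)]
    exact IsClique.card_le_cliqueNum (tc := by simpa using hcl')
  rw [ncard_edgesOn_diff_singleton G hv]
  have hc := Set.ncard_sdiff_singleton_add_one hv
  -- The last vertex eliminated contributes no edge, which turns `|U|` into `|U| - 1` in the bound.
  rcases (U \ {v}).eq_empty_or_nonempty with h0 | h0
  · have h2 : U ∩ G.neighborSet v = ∅ := by
      rw [Set.eq_empty_iff_forall_notMem]
      intro w hw
      have : w ∈ U \ {v} := ⟨hw.1, hw.2.ne'⟩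
      rw [h0] at this
      exact this
    rw [h2, ← hc, h0]
    simp
  · have := ih _ (by omega) h0 rfl
    rw [← hc, mul_add, mul_one]
    omega

/-- The forest induced on `U` extends to a spanning tree of the complete graph on `U`, with `|U| -
1` edges. -/
lemma IsAcyclic.ncard_edgesOn_add_one_le {T : SimpleGraph V} (hT : T.IsAcyclic) {U : Set V}
    (hU : U.Nonempty) : (T.edgesOn U).ncard + 1 ≤ U.ncard := by
  classical
  have := Fintype.ofFinite V
  have : Nonempty U := hU.to_subtype
  obtain ⟨F, hF, -, hFT⟩ := (connected_top (V := U)).exists_isTree_le_of_le_of_isAcyclic le_top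
    (hT.induce U)
  have h := hFT.card_edgeFinset
  rw [ncard_edgesOn, ← Nat.card_coe_set_eq U, Nat.card_eq_fintype_card (α := U), ← h,
    Nat.card_eq_fintype_card, ← edgeFinset_card]
  exact Nat.succ_le_succ (Finset.card_le_card (by simpa using hF))

omit [Finite V] in
lemma ncard_le_ncard_edgesOn_add_one {F : SimpleGraph V} {U : Set V}
    (hF : (F.induce U).Connected) : U.ncard ≤ (F.edgesOn U).ncard + 1 := by
  rw [ncard_edgesOn, ← Nat.card_coe_set_eq U]
  exact hF.card_vert_le_card_edgeSet_add_one

lemma ncard_edgeSet_eq_sum_edgesOn {ι : Type*} [Fintype ι] (H : SimpleGraph V) (f : V → ι)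
    (hf : ∀ x y, H.Adj x y → f x = f y) :
    H.edgeSet.ncard = ∑ i, (H.edgesOn (f ⁻¹' {i})).ncard := by
  rw [← finsum_eq_sum_of_fintype, ← Set.ncard_iUnion_of_finite (fun i => Set.toFinite _)]
  · congr 1
    ext e
    induction e with
    | _ x y =>
      simp only [mem_edgeSet, Set.mem_iUnion, mk_mem_edgesOn, Set.mem_preimage,
        Set.mem_singleton_iff]
      exact ⟨fun h => ⟨f y, h, hf x y h, rfl⟩, fun ⟨_, h, _⟩ => h⟩
  · intro i j hij
    rw [Function.onFun, Set.disjoint_left]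
    intro e
    induction e with
    | _ x y =>
      intro h1 h2
      exact hij ((mk_mem_edgesOn.1 h1).2.1.symm.trans (mk_mem_edgesOn.1 h2).2.1)

/-- If `t * e(U) ≤ |U| - 1` for all nonempty `U`, then `t * e(H) ≤ e(F)` for every spanning forest
`F` of a subgraph `H`. -/
lemma mul_ncard_edgeSet_le {G H F : SimpleGraph V} {t : ℝ} (ht0 : 0 ≤ t)
    (ht : ∀ U : Set V, U.Nonempty → t * (G.edgesOn U).ncard ≤ U.ncard - 1) (hHG : H ≤ G)
    (hr : F.Reachable = H.Reachable) :
    t * H.edgeSet.ncard ≤ F.edgeSet.ncard := by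
  classical
  have := Fintype.ofFinite F.ConnectedComponent
  -- `F` and `H` have the same components `K`, so both edge counts split over them; on each, `t *
  -- e_H(K) ≤ t * e_G(K) ≤ |K| - 1 ≤ e_F(K)`.
  rw [ncard_edgeSet_eq_sum_edgesOn H F.connectedComponentMk fun x y h => by
      rw [ConnectedComponent.eq, hr]; exact h.reachable,
    ncard_edgeSet_eq_sum_edgesOn F F.connectedComponentMk fun x y h =>
      ConnectedComponent.sound h.reachable]
  push_cast
  rw [Finset.mul_sum]
  refine Finset.sum_le_sum fun K _ => ?_
  have h1 := ht (F.connectedComponentMk ⁻¹' {K}) K.nonempty_supp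
  have h2 : (F.connectedComponentMk ⁻¹' {K}).ncard ≤
      (F.edgesOn (F.connectedComponentMk ⁻¹' {K})).ncard + 1 :=
    ncard_le_ncard_edgesOn_add_one K.connected_toSimpleGraph
  have h3 : (H.edgesOn (F.connectedComponentMk ⁻¹' {K})).ncard ≤
      (G.edgesOn (F.connectedComponentMk ⁻¹' {K})).ncard :=
    Set.ncard_le_ncard (edgesOn_mono_left hHG _)
  have h2' : ((F.connectedComponentMk ⁻¹' {K}).ncard : ℝ) ≤
      (F.edgesOn (F.connectedComponentMk ⁻¹' {K})).ncard + 1 := by exact_mod_cast h2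
  have h3' : ((H.edgesOn (F.connectedComponentMk ⁻¹' {K})).ncard : ℝ) ≤
      (G.edgesOn (F.connectedComponentMk ⁻¹' {K})).ncard := by exact_mod_cast h3
  have := mul_le_mul_of_nonneg_left h3' ht0
  linarith

lemma ncard_edgesOn_union_le (G : SimpleGraph V) {U W : Set V}
    (h : ∀ x ∈ U, ∀ y ∈ W, ¬ G.Adj x y) :
    (G.edgesOn (U ∪ W)).ncard ≤ (G.edgesOn U).ncard + (G.edgesOn W).ncard := by
  refine (Set.ncard_le_ncard ?_).trans (Set.ncard_union_le _ _)
  intro e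
  induction e with
  | _ x y =>
    simp only [mk_mem_edgesOn, Set.mem_union]
    rintro ⟨hxy, hx | hx, hy | hy⟩
    · exact Or.inl ⟨hxy, hx, hy⟩
    · exact absurd hxy (h x hx y hy)
    · exact absurd hxy.symm (h y hy x hx)
    · exact Or.inr ⟨hxy, hx, hy⟩

end Counting

/-! ### 0-1 weightings and edge counts of their supports -/

section Weights

variable {V : Type*} {G : SimpleGraph V}

lemma nonempty_of_edgesOn {U : Set V} (hU : (G.edgesOn U).Nonempty) : U.Nonempty := by
  by_contra h
  rw [Set.not_nonempty_iff_eq_empty] at h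
  simp [h] at hU

/-- The 0-1 weighting that is one on the edges with both end points in `U`. -/
noncomputable def indicatorWeighting (G : SimpleGraph V) (U : Set V) (e : G.edgeSet) : ℝ :=
  (G.edgesOn U).indicator 1 (e : Sym2 V)

lemma indicatorWeighting_eq_one_iff {U : Set V} {e : G.edgeSet} :
    G.indicatorWeighting U e = 1 ↔ (e : Sym2 V) ∈ G.edgesOn U := by
  classical
  simp [indicatorWeighting, Set.indicator_apply]

lemma isZeroOneWeighting_indicatorWeighting {U : Set V} (hU : (G.edgesOn U).Nonempty) :
    G.IsZeroOneWeighting (G.indicatorWeighting U) := by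
  classical
  refine ⟨fun e => ?_, ?_⟩
  · simp only [indicatorWeighting, Set.indicator_apply, Pi.one_apply]
    split_ifs <;> simp
  · obtain ⟨e, he⟩ := hU
    refine ⟨⟨e, he.1⟩, ?_⟩
    rw [indicatorWeighting_eq_one_iff.2 he]
    exact one_ne_zero

lemma supportSubgraph_indicatorWeighting_adj {U : Set V} {x y : V} :
    (G.supportSubgraph (G.indicatorWeighting U)).Adj x y ↔ G.Adj x y ∧ x ∈ U ∧ y ∈ U := by
  simp only [supportSubgraph, indicatorWeighting_eq_one_iff, mk_mem_edgesOn, exists_prop]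
  tauto

lemma edgeSet_supportSubgraph_indicatorWeighting {U : Set V} :
    (G.supportSubgraph (G.indicatorWeighting U)).spanningCoe.edgeSet = G.edgesOn U := by
  ext e
  induction e with
  | _ x y =>
    rw [mem_edgeSet, Subgraph.spanningCoe_adj, supportSubgraph_indicatorWeighting_adj,
      mk_mem_edgesOn]

variable [Fintype V]

lemma IsZeroOneWeighting.totalWeight_eq {ω : G.edgeSet → ℝ} (hω : G.IsZeroOneWeighting ω) :
    G.totalWeight ω = (G.supportSubgraph ω).spanningCoe.edgeSet.ncard := by
  classical
  have h : (G.supportSubgraph ω).spanningCoe.edgeSet =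
      Subtype.val '' {e : G.edgeSet | ω e = 1} := by
    ext e
    induction e with
    | _ x y => simp [supportSubgraph]
  rw [h, Set.ncard_image_of_injective _ Subtype.val_injective, totalWeight,
    Set.ncard_eq_toFinset_card', Set.toFinset_ofPred, Finset.card_filter]
  push_cast
  refine Finset.sum_congr rfl fun e _ => ?_
  rcases hω.1 e with h | h <;> simp [h]

lemma IsZeroOneWeighting.weightOf_eq {ω : G.edgeSet → ℝ} (hω : G.IsZeroOneWeighting ω)
    (T : SimpleGraph V) :
    G.weightOf ω T = (T ⊓ (G.supportSubgraph ω).spanningCoe).edgeSet.ncard := by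
  classical
  have h : (T ⊓ (G.supportSubgraph ω).spanningCoe).edgeSet =
      Subtype.val '' {e : G.edgeSet | (e : Sym2 V) ∈ T.edgeSet ∧ ω e = 1} := by
    ext e
    induction e with
    | _ x y => simp [supportSubgraph]
  rw [h, Set.ncard_image_of_injective _ Subtype.val_injective, weightOf,
    Set.ncard_eq_toFinset_card', Set.toFinset_ofPred, Finset.card_filter]
  push_cast
  refine Finset.sum_congr rfl fun e _ => ?_
  rcases hω.1 e with h | h <;> simp [h]

lemma IsZeroOneWeighting.totalWeight_pos {ω : G.edgeSet → ℝ} (hω : G.IsZeroOneWeighting ω) :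
    0 < G.totalWeight ω := by
  classical
  obtain ⟨e, he⟩ := hω.2
  have h0 : ∀ e, 0 ≤ ω e := fun e => by rcases hω.1 e with h | h <;> simp [h]
  rw [totalWeight]
  exact Finset.sum_pos' (fun e _ => h0 e) ⟨e, Finset.mem_univ _, (h0 e).lt_of_ne' he⟩

/-! ### Tight sets: optimality, degree bounds and bounds on the ratio -/

/-- `U` attains the least ratio `t` of `|U| - 1` and the number of edges on `U`. -/
structure IsTightSet (G : SimpleGraph V) (t : ℝ) (U : Set V) : Prop where
  pos : 0 < t
  edges_nonempty : (G.edgesOn U).Nonempty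
  eq : t * (G.edgesOn U).ncard = U.ncard - 1
  le : ∀ W : Set V, W.Nonempty → t * (G.edgesOn W).ncard ≤ W.ncard - 1

lemma one_lt_ncard_of_edgesOn {U : Set V} (hU : (G.edgesOn U).Nonempty) : 1 < U.ncard := by
  obtain ⟨e, he⟩ := hU
  induction e with
  | _ x y =>
    rw [mk_mem_edgesOn] at he
    exact (Set.one_lt_ncard (Set.toFinite _)).2 ⟨x, he.2.1, y, he.2.2, he.1.ne⟩

lemma exists_isTightSet (hE : G.edgeSet.Nonempty) : ∃ t U, G.IsTightSet t U := by
  have hne : ∃ U : Set V, (G.edgesOn U).Nonempty :=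
    ⟨Set.univ, hE.mono fun e he => ⟨he, fun _ _ => Set.mem_univ _⟩⟩
  obtain ⟨U, hU, hmin⟩ := (Set.toFinite {U : Set V | (G.edgesOn U).Nonempty}).exists_minimalFor
    (fun U => ((U.ncard : ℝ) - 1) / (G.edgesOn U).ncard) _ hne
  have hpos : ∀ W : Set V, (G.edgesOn W).Nonempty → (0 : ℝ) < (G.edgesOn W).ncard := fun W hW =>
    Nat.cast_pos.2 ((Set.ncard_pos).2 hW)
  have h1 : (1 : ℝ) < U.ncard := by exact_mod_cast one_lt_ncard_of_edgesOn hU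
  refine ⟨((U.ncard : ℝ) - 1) / (G.edgesOn U).ncard, U, div_pos (by linarith) (hpos U hU), hU,
    div_mul_cancel₀ _ (hpos U hU).ne', fun W hW => ?_⟩
  -- Sets without edges do not compete in the minimum, but for them the inequality is just `0 ≤ |W|
  -- - 1`.
  rcases (G.edgesOn W).eq_empty_or_nonempty with h0 | h0
  · have : (1 : ℝ) ≤ W.ncard := by exact_mod_cast (Set.ncard_pos).2 hW
    rw [h0]
    simpa using this
  · rw [← le_div_iff₀ (hpos W h0)]
    rcases le_total (((U.ncard : ℝ) - 1) / (G.edgesOn U).ncard)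
      (((W.ncard : ℝ) - 1) / (G.edgesOn W).ncard) with h | h
    · exact h
    · exact hmin h0 h

namespace IsTightSet

variable {t : ℝ} {U : Set V}

omit [Fintype V] in
lemma nonempty (h : G.IsTightSet t U) : U.Nonempty :=
  nonempty_of_edgesOn h.edges_nonempty

lemma le_weightingRatio (h : G.IsTightSet t U) {ω : G.edgeSet → ℝ}
    (hω : G.IsZeroOneWeighting ω) : t ≤ G.weightingRatio ω := by
  set H := (G.supportSubgraph ω).spanningCoe with hH
  have hHG : H ≤ G := Subgraph.spanningCoe_le _
  rw [weightingRatio, le_div_iff₀ hω.totalWeight_pos, hω.totalWeight_eq]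
  -- A spanning forest of the support, extended to one of `G`, bounds the maximum weight from below.
  obtain ⟨F, hFH, hFa, hFr⟩ := H.exists_isAcyclic_reachable_eq_le
  obtain ⟨T, hFT, hTG, hTa, hTr⟩ :=
    G.exists_isAcyclic_reachable_eq_le_of_le_of_isAcyclic (hFH.trans hHG) hFa
  have h1 := mul_ncard_edgeSet_le h.pos.le h.le hHG hFr
  have h2 : (F.edgeSet.ncard : ℝ) ≤ G.weightOf ω T := by
    rw [hω.weightOf_eq]
    exact_mod_cast Set.ncard_le_ncard (edgeSet_mono (le_inf hFT hFH))
  exact h1.trans (h2.trans ((G.isGreatest_maxSpanningWeight ω).2 ⟨T, ⟨hTG, hTa, hTr⟩, rfl⟩))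

lemma weightingRatio_eq (h : G.IsTightSet t U) :
    G.weightingRatio (G.indicatorWeighting U) = t := by
  have hω := isZeroOneWeighting_indicatorWeighting h.edges_nonempty
  refine le_antisymm ?_ (h.le_weightingRatio hω)
  rw [weightingRatio, div_le_iff₀ hω.totalWeight_pos, hω.totalWeight_eq,
    edgeSet_supportSubgraph_indicatorWeighting, h.eq]
  obtain ⟨T, hT, hw⟩ := (G.isGreatest_maxSpanningWeight (G.indicatorWeighting U)).1
  rw [hw, hω.weightOf_eq, edgeSet_inf, edgeSet_supportSubgraph_indicatorWeighting]
  have h1 : (T.edgeSet ∩ G.edgesOn U).ncard ≤ (T.edgesOn U).ncard :=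
    Set.ncard_le_ncard fun e he => ⟨he.1, he.2.2⟩
  have h2 := hT.2.1.ncard_edgesOn_add_one_le h.nonempty
  rw [le_sub_iff_add_le]
  exact_mod_cast (Nat.succ_le_succ h1).trans h2

lemma isOptimalZeroOneWeighting (h : G.IsTightSet t U) :
    G.IsOptimalZeroOneWeighting (G.indicatorWeighting U) :=
  ⟨isZeroOneWeighting_indicatorWeighting h.edges_nonempty, fun _ hω =>
    h.weightingRatio_eq.le.trans (h.le_weightingRatio hω)⟩

/-- Vertices of a tight set have degree at least `1 / t`. -/
lemma one_le_mul_degree (h : G.IsTightSet t U) {v : V} (hv : v ∈ U) :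
    1 ≤ t * (U ∩ G.neighborSet v).ncard := by
  have h1 := one_lt_ncard_of_edgesOn h.edges_nonempty
  have h2 := Set.ncard_sdiff_singleton_add_one hv
  have h3 := h.le (U \ {v}) ((Set.ncard_pos).1 (by omega))
  have h4 := h.eq
  rw [ncard_edgesOn_diff_singleton G hv, ← h2] at h4
  push_cast at h4
  linarith

/-- Vertices outside a tight set have at most `1 / t` neighbours in it. -/
lemma mul_degree_le_one (h : G.IsTightSet t U) {x : V} (hx : x ∉ U) :
    t * (U ∩ G.neighborSet x).ncard ≤ 1 := by
  have h1 := h.le (insert x U) (Set.insert_nonempty _ _)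
  rw [ncard_edgesOn_insert G hx, Set.ncard_insert_of_notMem hx] at h1
  have h2 := h.eq
  push_cast at h1
  linarith

/-- If `U` split into `A` and `B` with no edges between, adding the bounds for both would give `t *
e(U) ≤ |U| - 2`. -/
lemma connected_induce (h : G.IsTightSet t U) : (G.induce U).Connected := by
  have hne : Nonempty U := h.nonempty.to_subtype
  rw [connected_iff_exists_forall_reachable]
  obtain ⟨u⟩ := hne
  refine ⟨u, ?_⟩
  by_contra hcon
  push Not at hcon
  obtain ⟨w, hw⟩ := hcon
  let A : Set V := Subtype.val '' {x : U | (G.induce U).Reachable u x}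
  let B : Set V := Subtype.val '' {x : U | ¬ (G.induce U).Reachable u x}
  have hAB : A ∪ B = U := by
    rw [← Set.image_union, ← Set.ofPred_or]
    simp [em]
  have hdisj : Disjoint A B := by
    rw [Set.disjoint_image_iff Subtype.val_injective]
    exact disjoint_compl_right
  have hA := h.le A ⟨u, u, Reachable.refl _, rfl⟩
  have hB := h.le B ⟨w, w, hw, rfl⟩
  have he := ncard_edgesOn_union_le G (U := A) (W := B) (by
    rintro _ ⟨x, hx, rfl⟩ _ ⟨y, hy, rfl⟩ hxy
    have hxy' : (G.induce U).Adj x y := hxy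
    exact hy (Reachable.trans hx hxy'.reachable))
  have hn := Set.ncard_union_eq hdisj
  rw [hAB] at he hn
  have h2 := h.eq
  rw [hn] at h2
  push_cast at h2
  have he' : ((G.edgesOn U).ncard : ℝ) ≤ (G.edgesOn A).ncard + (G.edgesOn B).ncard := by
    exact_mod_cast he
  have := mul_le_mul_of_nonneg_left he' h.pos.le
  linarith

lemma two_le_cliqueNum (h : G.IsTightSet t U) : 2 ≤ G.cliqueNum := by
  classical
  obtain ⟨e, he⟩ := h.edges_nonempty
  induction e with
  | _ x y =>
    have hxy := (mk_mem_edgesOn.1 he).1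
    have hc : G.IsClique (({x, y} : Finset V) : Set V) := by
      simpa [isClique_pair] using fun _ => hxy
    have := hc.card_le_cliqueNum
    rwa [Finset.card_pair hxy.ne] at this

lemma mul_cliqueNum_le_two (h : G.IsTightSet t U) : t * G.cliqueNum ≤ 2 := by
  obtain ⟨K, hK⟩ := G.exists_isNClique_cliqueNum
  have h2 := h.two_le_cliqueNum
  have h1 := ncard_edgesOn_of_isClique hK.isClique
  rw [Set.ncard_coe_finset, hK.card_eq] at h1
  have h3 := h.le K (by rw [Finset.coe_nonempty, ← Finset.card_pos, hK.card_eq]; omega)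
  rw [Set.ncard_coe_finset, hK.card_eq] at h3
  -- Here `s` is the clique number minus two. Testing `t` on a maximum clique gives `t * (s + 2)(s +
  -- 1) / 2 ≤ s + 1`, and the factor `s + 1` cancels.
  obtain ⟨s, hs⟩ : ∃ s, G.cliqueNum = s + 2 := ⟨_, (Nat.sub_add_cancel h2).symm⟩
  rw [hs] at h1 h3 ⊢
  have h1' : 2 * ((G.edgesOn (K : Set V)).ncard : ℝ) = (s + 2) * (s + 1) := by exact_mod_cast h1
  push_cast at h3 ⊢
  have hs' : (0 : ℝ) ≤ s := Nat.cast_nonneg s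
  refine le_of_mul_le_mul_right (a := (s : ℝ) + 1) ?_ (by linarith)
  have h5 : t * (s + 2) * (s + 1) = 2 * (t * (G.edgesOn (K : Set V)).ncard) := by
    rw [mul_assoc, ← h1']
    ring
  linarith

lemma one_le_mul_cliqueNum (h : G.IsTightSet t U) (hG : G.IsChordal) :
    1 ≤ t * (G.cliqueNum - 1) := by
  have h1 := hG.ncard_edgesOn_add_le h.nonempty
  have h2 := h.two_le_cliqueNum
  have h3 := one_lt_ncard_of_edgesOn h.edges_nonempty
  have h4 := h.eq
  obtain ⟨s, hs⟩ : ∃ s, G.cliqueNum = s + 1 := ⟨_, (Nat.sub_add_cancel (by omega)).symm⟩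
  rw [hs] at h1 ⊢
  simp only [Nat.add_sub_cancel] at h1
  have h1' : ((G.edgesOn U).ncard : ℝ) + s ≤ s * U.ncard := by exact_mod_cast h1
  have h3' : (1 : ℝ) < U.ncard := by exact_mod_cast h3
  push_cast
  refine le_of_mul_le_mul_right (a := (U.ncard : ℝ) - 1) ?_ (by linarith)
  have := mul_le_mul_of_nonneg_left h1' h.pos.le
  -- With `t * e(U) = |U| - 1`, the edge bound multiplied by `t` reads `|U| - 1 ≤ t * s * (|U| -
  -- 1)`.
  nlinarith

/-- No vertex of `U` is isolated in `G[U]`, by the lower degree bound; so no vertex is lost on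
passing to the edge-induced subgraph. -/
lemma verts_supportSubgraph (h : G.IsTightSet t U) :
    (G.supportSubgraph (G.indicatorWeighting U)).verts = U := by
  ext x
  constructor
  · rintro ⟨y, hy⟩
    exact (supportSubgraph_indicatorWeighting_adj.1 hy).2.1
  · intro hx
    have h1 := h.one_le_mul_degree hx
    have h2 : (U ∩ G.neighborSet x).Nonempty := by
      rw [Set.nonempty_iff_ne_empty]
      intro h0
      rw [h0] at h1
      norm_num at h1
    obtain ⟨y, hy, hxy⟩ := h2
    exact ⟨y, supportSubgraph_indicatorWeighting_adj.2 ⟨hxy, hx, hy⟩⟩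

end IsTightSet

end Weights

/-! ### Clique graphs and private vertices of their leaves -/

section CliqueGraphs

variable {W : Type*} {F : SimpleGraph W}

lemma mem_verts_cliqueUnion {P : Set F.MaxClique} {C : F.MaxClique} (hC : C ∈ P) {v : W}
    (hv : v ∈ C.1) : v ∈ (F.cliqueUnion P).verts := by
  have : (⊤ : F.Subgraph).induce C.1 ≤ F.cliqueUnion P := le_iSup₂_of_le C hC le_rfl
  exact this.1 hv

/-- In a clique graph, the maximal cliques that contain a given vertex induce a connected
subgraph. -/
lemma CliqueGraphState.reflTransGen {P : Set F.MaxClique} {H : SimpleGraph F.MaxClique}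
    (h : F.CliqueGraphState P H) (v : W) {C D : F.MaxClique} (hC : C ∈ P) (hD : D ∈ P)
    (hvC : v ∈ C.1) (hvD : v ∈ D.1) :
    Relation.ReflTransGen (fun A B => H.Adj A B ∧ v ∈ A.1 ∧ v ∈ B.1) C D := by
  have hsymm : ∀ H' : SimpleGraph F.MaxClique,
      Std.Symm (fun A B : F.MaxClique => H'.Adj A B ∧ v ∈ A.1 ∧ v ∈ B.1) :=
    fun H' => ⟨fun _ _ h => ⟨h.1.symm, h.2.2, h.2.1⟩⟩
  induction h generalizing C D with
  | start => exact absurd hC (Set.notMem_empty _)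
  | disjoint P H K hs hK hdisj ih =>
    have hno : ∀ E ∈ P, v ∈ E.1 → v ∉ K.1 := fun E hE hvE hvK =>
      Set.eq_empty_iff_forall_notMem.1 hdisj v ⟨hvK, mem_verts_cliqueUnion hE hvE⟩
    rcases hC with rfl | hC
    · rcases hD with rfl | hD
      · exact .refl
      · exact absurd hvC (hno D hD hvD)
    · rcases hD with rfl | hD
      · exact absurd hvD (hno C hC hvC)
      · exact ih hC hD hvC hvD
  | meet P H K k S D' hs hK hne hS hU hD' ih =>
    have hKP : K ∉ P := fun h => hK (le_iSup₂_of_le K h le_rfl)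
    have hmono : ∀ {A B : F.MaxClique}, A ∈ P → B ∈ P → v ∈ A.1 → v ∈ B.1 →
        Relation.ReflTransGen
          (fun A B => (H ⊔ starEdges K D').Adj A B ∧ v ∈ A.1 ∧ v ∈ B.1) A B :=
      fun hA hB hvA hvB => Relation.ReflTransGen.mono (fun _ _ h => ⟨Or.inl h.1, h.2⟩) _ _ (ih hA hB hvA hvB)
    -- `v` lies in some `S i`, hence in `D i`, so the new edge from `K` to `D i` stays among the
    -- cliques through `v`; induction leads from `D i` to `E`.
    have hnew : ∀ E ∈ P, v ∈ E.1 → v ∈ K.1 → Relation.ReflTransGen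
        (fun A B => (H ⊔ starEdges K D').Adj A B ∧ v ∈ A.1 ∧ v ∈ B.1) K E := by
      intro E hE hvE hvK
      have hv : v ∈ ⋃ i, S i := by
        rw [hU]
        exact ⟨hvK, mem_verts_cliqueUnion hE hvE⟩
      obtain ⟨i, hi⟩ := Set.mem_iUnion.1 hv
      obtain ⟨hDP, hSD⟩ := hD' i
      refine .head ⟨Or.inr ?_, hvK, hSD hi⟩ (hmono hDP hE (hSD hi) hvE)
      rw [starEdges, fromEdgeSet_adj]
      exact ⟨⟨i, rfl⟩, fun h => hKP (h ▸ hDP)⟩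
    rcases hC with rfl | hC
    · rcases hD with rfl | hD
      · exact .refl
      · exact hnew D hD hvD hvC
    · rcases hD with rfl | hD
      · have := hsymm (H ⊔ starEdges D D')
        exact (Relation.ReflTransGen.stdSymm).symm _ _ (hnew C hC hvC hvD)
      · exact hmono hC hD hvC hvD

/-- On an empty vertex type `∅` itself is a maximal clique, hence `Nonempty W`. -/
lemma MaxClique.nonempty [Nonempty W] (C : F.MaxClique) : C.1.Nonempty := by
  by_contra h
  rw [Set.not_nonempty_iff_eq_empty] at h
  obtain ⟨w⟩ := ‹Nonempty W›
  have := C.2.le_of_ge (y := {w}) (Set.pairwise_singleton _ _) (by simp [h])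
  rw [h] at this
  exact this rfl

/-- A leaf of a clique graph has a vertex that lies in no other maximal clique. -/
lemma IsCliqueGraph.exists_mem_unique [Finite W] [Nonempty W] {H : SimpleGraph F.MaxClique}
    (h : F.IsCliqueGraph H) {C : F.MaxClique} (hC : (H.neighborSet C).ncard ≤ 1) :
    ∃ v ∈ C.1, ∀ D : F.MaxClique, v ∈ D.1 → D = C := by
  -- The first edge on a path from `C` to `D` through cliques containing `v`. If `B` is the only
  -- neighbour of `C`, any vertex of `C \ B` is therefore private to `C`.
  have step : ∀ v ∈ C.1, ∀ D : F.MaxClique, v ∈ D.1 → D = C ∨ ∃ B, H.Adj C B ∧ v ∈ B.1 := by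
    intro v hv D hD
    rcases (CliqueGraphState.reflTransGen h v (Set.mem_univ C) (Set.mem_univ D) hv hD).cases_head
      with rfl | ⟨B, hB, -⟩
    · exact Or.inl rfl
    · exact Or.inr ⟨B, hB.1, hB.2.2⟩
  rcases (H.neighborSet C).eq_empty_or_nonempty with h0 | ⟨B, hB⟩
  · obtain ⟨v, hv⟩ := MaxClique.nonempty C
    refine ⟨v, hv, fun D hD => (step v hv D hD).resolve_right ?_⟩
    rintro ⟨B, hB, -⟩
    exact Set.eq_empty_iff_forall_notMem.1 h0 B hB
  · have hnot : ¬ C.1 ⊆ B.1 := fun hle =>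
      H.ne_of_adj hB (Subtype.ext (C.2.eq_of_subset B.2.prop hle))
    obtain ⟨v, hv, hvB⟩ := Set.not_subset.1 hnot
    refine ⟨v, hv, fun D hD => (step v hv D hD).resolve_right ?_⟩
    rintro ⟨B', hB', hvB'⟩
    rw [(Set.ncard_le_one (Set.toFinite _)).1 hC B' hB' B hB] at hvB'
    exact hvB hvB'

/-- A vertex that lies in a single maximal clique has no neighbours outside this clique. -/
lemma mem_maxClique_of_adj [Finite W] {C : F.MaxClique} {v w : W}
    (hv : ∀ D : F.MaxClique, v ∈ D.1 → D = C) (h : F.Adj v w) : w ∈ C.1 := by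
  have hp : F.IsClique {v, w} := isClique_pair.2 fun _ => h
  obtain ⟨D, hle, hD⟩ := (Set.toFinite {K : Set W | F.IsClique K}).exists_le_maximal hp
  have := hv ⟨D, hD⟩ (hle (by simp))
  rw [← this]
  exact hle (by simp)

end CliqueGraphs

/-! ### The graph induced on a tight set and its leaf cliques -/

namespace IsTightSet

variable {V : Type*} [Fintype V] {G : SimpleGraph V} {t : ℝ} {U : Set V}

lemma coe_adj (h : G.IsTightSet t U)
    {x y : (G.supportSubgraph (G.indicatorWeighting U)).verts} :
    (G.supportSubgraph (G.indicatorWeighting U)).coe.Adj x y ↔ G.Adj (x : V) y := by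
  have hx : (x : V) ∈ U := h.verts_supportSubgraph.subset x.2
  have hy : (y : V) ∈ U := h.verts_supportSubgraph.subset y.2
  rw [Subgraph.coe_adj, supportSubgraph_indicatorWeighting_adj]
  exact ⟨fun h => h.1, fun h => ⟨h, hx, hy⟩⟩

/-- The subgraph supporting the weighting of a tight set is an induced subgraph. -/
def coeEmbedding (h : G.IsTightSet t U) :
    (G.supportSubgraph (G.indicatorWeighting U)).coe ↪g G where
  toFun := Subtype.val
  inj' := Subtype.val_injective
  map_rel_iff' := h.coe_adj.symm

lemma supportSubgraph_eq_induce (h : G.IsTightSet t U) :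
    G.supportSubgraph (G.indicatorWeighting U) = (⊤ : G.Subgraph).induce U := by
  refine Subgraph.ext h.verts_supportSubgraph ?_
  ext x y
  rw [supportSubgraph_indicatorWeighting_adj, Subgraph.induce_adj, Subgraph.top_adj]
  tauto

lemma connected_supportSubgraph (h : G.IsTightSet t U) :
    (G.supportSubgraph (G.indicatorWeighting U)).Connected := by
  rw [h.supportSubgraph_eq_induce, ← connected_induce_iff]
  exact h.connected_induce

omit [Fintype V] in
lemma neighborSet_supportSubgraph {v : V} (hv : v ∈ U) :
    (G.supportSubgraph (G.indicatorWeighting U)).neighborSet v = U ∩ G.neighborSet v := by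
  ext w
  rw [Subgraph.mem_neighborSet, supportSubgraph_indicatorWeighting_adj]
  exact ⟨fun h => ⟨h.2.2, h.1⟩, fun h => ⟨h.2, hv, h.1⟩⟩

/-- A maximal clique on a tight set that has a vertex in no other maximal clique is a maximal clique
of the whole graph: the degree bounds for vertices inside and outside of the tight set contradict
each other otherwise. -/
lemma maximal_isClique_image (h : G.IsTightSet t U)
    (C : (G.supportSubgraph (G.indicatorWeighting U)).coe.MaxClique)
    {v : (G.supportSubgraph (G.indicatorWeighting U)).verts} (hvC : v ∈ C.1)
    (hv : ∀ D : (G.supportSubgraph (G.indicatorWeighting U)).coe.MaxClique, v ∈ D.1 → D = C) :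
    Maximal G.IsClique (Subtype.val '' C.1) := by
  have hU : ∀ x : (G.supportSubgraph (G.indicatorWeighting U)).verts, (x : V) ∈ U :=
    fun x => h.verts_supportSubgraph.subset x.2
  refine ⟨?_, fun K hK hCK => ?_⟩
  · rintro _ ⟨x, hx, rfl⟩ _ ⟨y, hy, rfl⟩ hxy
    exact h.coe_adj.1 (C.2.prop hx hy fun e => hxy (congrArg _ e))
  intro x hxK
  by_contra hxC
  have hadj : ∀ y ∈ C.1, G.Adj x y := fun y hy =>
    hK hxK (hCK ⟨y, hy, rfl⟩) fun e => hxC (e ▸ ⟨y, hy, rfl⟩)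
  -- Inside `U`, the vertex `x` would already extend `C` in `F`.
  have hxU : x ∉ U := fun hxU => by
    have hx : x ∈ (G.supportSubgraph (G.indicatorWeighting U)).verts := by
      rwa [h.verts_supportSubgraph]
    have hcl : (G.supportSubgraph (G.indicatorWeighting U)).coe.IsClique (insert ⟨x, hx⟩ C.1) :=
      C.2.prop.insert fun y hy _ => h.coe_adj.2 (hadj y hy)
    exact hxC ⟨⟨x, hx⟩, C.2.le_of_ge hcl (Set.subset_insert _ _) (Set.mem_insert _ _), rfl⟩
  have h1 := h.one_le_mul_degree (hU v)
  have h2 := h.mul_degree_le_one hxU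
  -- All neighbours of `v` in `U` lie in `C`, hence are neighbours of `x`; and `v` itself is one
  -- more.
  have h3 : (U ∩ G.neighborSet v).ncard < (U ∩ G.neighborSet x).ncard := by
    refine Set.ncard_lt_ncard ((Set.ssubset_iff_of_subset ?_).2 ⟨v, ⟨hU v, hadj v hvC⟩, ?_⟩)
    · rintro w ⟨hw, hvw⟩
      have hw' : w ∈ (G.supportSubgraph (G.indicatorWeighting U)).verts := by
        rwa [h.verts_supportSubgraph]
      exact ⟨hw, hadj ⟨w, hw'⟩ (mem_maxClique_of_adj hv (h.coe_adj.2 hvw))⟩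
    · exact fun hvv => G.loopless.irrefl _ hvv.2
  have h3' : ((U ∩ G.neighborSet v).ncard : ℝ) < (U ∩ G.neighborSet x).ncard := by
    exact_mod_cast h3
  have := mul_lt_mul_of_pos_left h3' h.pos
  linarith

end IsTightSet

end SimpleGraph

theorem theorem3 {V : Type*} [Fintype V] (G : SimpleGraph V) (hG : G.IsChordal)
    (hE : G.edgeSet.Nonempty) :
    ∃ ω : G.edgeSet → ℝ, G.IsOptimalZeroOneWeighting ω ∧
      ((G.supportSubgraph ω).Connected ∧ (G.supportSubgraph ω).coe.IsChordal ∧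
        ∀ H : SimpleGraph (G.supportSubgraph ω).coe.MaxClique,
          (G.supportSubgraph ω).coe.IsCliqueGraph H → H.IsTree →
          ∀ C : (G.supportSubgraph ω).coe.MaxClique, (H.neighborSet C).ncard ≤ 1 →
            Maximal G.IsClique (Subtype.val '' C.1)) ∧
      (∀ v ∈ (G.supportSubgraph ω).verts,
        (G.cliqueNum : ℝ) / 2 ≤ (((G.supportSubgraph ω).neighborSet v).ncard : ℝ)) ∧
      1 / ((G.cliqueNum : ℝ) - 1) ≤ G.weightingRatio ω ∧
      G.weightingRatio ω ≤ 2 / (G.cliqueNum : ℝ) := by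
  obtain ⟨t, U, h⟩ := SimpleGraph.exists_isTightSet hE
  have hs : (2 : ℝ) ≤ G.cliqueNum := by exact_mod_cast h.two_le_cliqueNum
  have hts := h.mul_cliqueNum_le_two
  refine ⟨G.indicatorWeighting U, h.isOptimalZeroOneWeighting,
    ⟨h.connected_supportSubgraph, hG.of_embedding h.coeEmbedding, ?_⟩, ?_, ?_, ?_⟩
  · intro H hH _ C hC
    have : Nonempty (G.supportSubgraph (G.indicatorWeighting U)).verts :=
      h.connected_supportSubgraph.nonempty.to_subtype
    obtain ⟨v, hvC, hv⟩ := hH.exists_mem_unique hC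
    exact h.maximal_isClique_image C hvC hv
  · intro v hv
    rw [h.verts_supportSubgraph] at hv
    rw [SimpleGraph.IsTightSet.neighborSet_supportSubgraph hv]
    have h1 := h.one_le_mul_degree hv
    -- After multiplication by `t` the claim is `t * s / 2 ≤ 1 ≤ t * d(v)`.
    refine le_of_mul_le_mul_left ?_ h.pos
    linarith
  · rw [h.weightingRatio_eq, div_le_iff₀ (by linarith)]
    exact h.one_le_mul_cliqueNum hG
  · rw [h.weightingRatio_eq, le_div_iff₀ (by linarith)]
    exact hts
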